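/- Consider a finite discounted MDP with states $\mathcal X$, actions $\mathcal A$, costs $c:\mathcal X\times\mathcal A\to[-1,1]$, transition kernel $P$, initial distribution $\alpha$ and discount factor $\gamma\in(0,1)$. For a stationary policy $\pi$ with induced transition matrix $P_\pi$ and induced cost $c_\pi(x)=\sum_a\pi(a|x)c(x,a)$, let $$J(\pi)=(1-\gamma)\,\alpha^\top\sum_{t\ge 0}\gamma^tP_\pi^t c_\pi,\qquad \nu_\pi^\top=(1-\gamma)\,\alpha^\top\sum_{t\ge0}\gamma^tP_\pi^t,\qquad \mu_\pi(x,a)=\nu_\pi(x)\pi(a|x).$$ Let $\pi_1,\dots,\pi_m$ be base policies, $\mu_i=\mu_{\pi_i}$, $\pi_w=\sum_iw_i\pi_i$ for $w$ in the probability simplex, and let $\pi_*=\pi_{w^*}$ where $w^*$ minimizes $J(\pi_w)$ over the simplex. For $\theta\in\mathbb R^m$ let $\xi_\theta=\sum_i\theta_i\mu_i$, $U(\theta)=\sum_{x,a}|\min(\xi_\theta(x,a),0)|$, and let $\pi_\theta(a|x)=[\xi_\theta(x,a)]_+/\sum_{a'}[\xi_\theta(x,a')]_+$ (uniform in $a$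 if $\xi_\theta(x,\cdot)\le0$). For $S>0$ let $\Theta=\{\theta:\sum_i\theta_i=1,\ \|\theta\|_2\le S\}$. Assume that $\lambda>0$ satisfies, for all $i,j\in[m]$ and all $(x,a)$, $$\frac{\lambda}{1+\lambda}\,\mu_j(x,a)\le\mu_i(x,a)\le\frac{1+\lambda}{\lambda}\,\mu_j(x,a).$$ Let $p,q\in[m]$ be any two indices (for instance, after relabelling, $p=1$ for a base policy of smallest value $J$ and $q=m$ for one of largest value), let $\theta^\circ=(1+\lambda)e_p-\lambda e_q$, assume $\theta^\circ\in\Theta$, and put $\varepsilon=\|\mu_p-\mu_{\pi_*}\|_1$ and $$B=J(\pi_*)+\varepsilon-\lambda\,(J(\pi_q)-J(\pi_p)).$$ Then: 1. $U(\theta^\circ)=0$. 2. $J(\pi_{\theta^\circ})\le B$. 3. If $H\ge 6/(1-\gamma)$ and $\widehat\theta$ is an exact minimizer over $\Theta$ of $\mathcal L(\theta)=c^\top\xi_\theta+H\,U(\theta)$, then $J(\pi_{\widehat\theta})\le B$. 4. For $\eta\in(0,1]$ put $H=1/\eta$ and $G'=\sqrt m+Hm$, and let $\widehat\theta=\frac1T\sum_{t=1}^T\theta_t$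 be the output after $T$ rounds of the projected stochastic subgradient method: $\theta_1=0$, $\theta_{t+1}=\Pi_\Theta\big(\theta_t-\tfrac{S}{G'\sqrt T}\,g_t\big)$, where $\Pi_\Theta$ is the Euclidean projection, and in each round one samples independently $i\in[m]$ uniformly, then $(x_t,a_t)\sim\mu_i$, and takes $$(g_t)_j=c^\top\mu_j-H\,\frac{m\,\mu_j(x_t,a_t)}{\sum_{i}\mu_i(x_t,a_t)}\,\mathbf 1\{\xi_{\theta_t}(x_t,a_t)<0\},\qquad j\in[m].$$ There is an absolute constant $K>0$ such that for every $\delta\in(0,1)$, $\eta\in(0,1]$ and every $T\ge K\,(S G'/\eta)^2\,(1+\log(1/\delta))$, with probability at least $1-\delta$, $$J(\pi_{\widehat\theta})\le B+K\,\frac{\sqrt m\,S}{1-\gamma}\,\eta .$$ -/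

import Mathlib

/-- A finite discounted Markov decision process: cost `c`, transition kernel `P`, initial
distribution `α` and discount factor `γ ∈ (0,1)`. -/
structure DiscountedMDP (X A : Type*) [Fintype X] where
  cost : X → A → ℝ
  P : X → A → X → ℝ
  P_mem : ∀ x a, P x a ∈ stdSimplex ℝ X
  init : X → ℝ
  init_mem : init ∈ stdSimplex ℝ X
  γ : ℝ
  γ_pos : 0 < γ
  γ_lt_one : γ < 1

/-- A function `π : X → A → ℝ` is a stationary policy, `π x a` being the probability `π(a|x)`. -/
def IsPolicy {X A : Type*} [Fintype A] (π : X → A → ℝ) : Prop :=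
  ∀ x, π x ∈ stdSimplex ℝ A

/-- The mixture policy `π_w = ∑ i, w i • π i`. -/
def mixturePolicy {X A : Type*} {m : ℕ} (π : Fin m → X → A → ℝ) (w : Fin m → ℝ) :
    X → A → ℝ :=
  fun x a => ∑ i, w i * π i x a

/-- The `ℓ¹` distance of two functions on state-action pairs. -/
def l1Dist {X A : Type*} [Fintype X] [Fintype A] (f g : X → A → ℝ) : ℝ :=
  ∑ x, ∑ a, |f x a - g x a|

namespace DiscountedMDP

variable {X A : Type*} [Fintype X] [DecidableEq X] [Fintype A] {m : ℕ}

/-- The transition matrix `P_π` of the Markov chain induced by `π`. -/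
def transition (M : DiscountedMDP X A) (π : X → A → ℝ) : Matrix X X ℝ :=
  Matrix.of fun x y => ∑ a, π x a * M.P x a y

/-- The cost function `c_π` of the Markov chain induced by `π`. -/
def policyCost (M : DiscountedMDP X A) (π : X → A → ℝ) : X → ℝ :=
  fun x => ∑ a, π x a * M.cost x a

/-- The (normalized) value function `J_π(x) = (1 - γ) ∑ₜ γᵗ E[c_π(X_t) | X_0 = x]`. -/
noncomputable def valueFn (M : DiscountedMDP X A) (π : X → A → ℝ) (x : X) : ℝ :=
  (1 - M.γ) * ∑' t : ℕ, M.γ ^ t * (((M.transition π) ^ t).mulVec (M.policyCost π)) x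

/-- `J(π) = αᵀ J_π`. -/
noncomputable def J (M : DiscountedMDP X A) (π : X → A → ℝ) : ℝ :=
  ∑ x, M.init x * M.valueFn π x

/-- The state occupancy measure `ν_π`. -/
noncomputable def stateOcc (M : DiscountedMDP X A) (π : X → A → ℝ) (x : X) : ℝ :=
  (1 - M.γ) * ∑ x', M.init x' * ∑' t : ℕ, M.γ ^ t * ((M.transition π) ^ t) x' x

/-- The state-action occupancy measure `μ_π(x,a) = ν_π(x) π(a|x)`. -/
noncomputable def occ (M : DiscountedMDP X A) (π : X → A → ℝ) : X → A → ℝ :=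
  fun x a => M.stateOcc π x * π x a

/-- `ξ_θ = ∑ i, θ i • μ_{π i}`. -/
noncomputable def xi (M : DiscountedMDP X A) (π : Fin m → X → A → ℝ)
    (θ : EuclideanSpace ℝ (Fin m)) : X → A → ℝ :=
  fun x a => ∑ i, θ i * M.occ (π i) x a

open Classical in
/-- The policy `π_θ` obtained by normalizing the positive part of `ξ_θ`; it is uniform in the states
where `ξ_θ` has no positive entry. -/
noncomputable def dualPolicy (M : DiscountedMDP X A) (π : Fin m → X → A → ℝ)
    (θ : EuclideanSpace ℝ (Fin m)) : X → A → ℝ :=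
  fun x a =>
    if ∀ a', M.xi π θ x a' ≤ 0 then 1 / (Fintype.card A : ℝ)
    else max (M.xi π θ x a) 0 / ∑ a', max (M.xi π θ x a') 0

/-- The constraint violation `U(θ) = ∑ |[ξ_θ(x,a)]₋|`, where `[v]₋ = v ∧ 0`. -/
noncomputable def violation (M : DiscountedMDP X A) (π : Fin m → X → A → ℝ)
    (θ : EuclideanSpace ℝ (Fin m)) : ℝ :=
  ∑ x, ∑ a, |min (M.xi π θ x a) 0|

/-- The convex surrogate `L(θ) = cᵀ ξ_θ + H ∑ |[ξ_θ(x,a)]₋|`. -/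
noncomputable def surrogate (M : DiscountedMDP X A) (π : Fin m → X → A → ℝ) (H : ℝ)
    (θ : EuclideanSpace ℝ (Fin m)) : ℝ :=
  (∑ x, ∑ a, M.cost x a * M.xi π θ x a) + H * M.violation π θ

open Classical in
/-- The stochastic subgradient `g(θ)` at a sampled state-action pair `(x, a)`. -/
noncomputable def subgrad (M : DiscountedMDP X A) (π : Fin m → X → A → ℝ) (H : ℝ)
    (θ : EuclideanSpace ℝ (Fin m)) (x : X) (a : A) : EuclideanSpace ℝ (Fin m) :=
  WithLp.toLp 2 fun j =>
    (∑ x', ∑ a', M.cost x' a' * M.occ (π j) x' a') -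
      H * (m * M.occ (π j) x a / ∑ i, M.occ (π i) x a) * (if M.xi π θ x a < 0 then 1 else 0)

end DiscountedMDP

/-- `Θ = {θ : ∑ i, θ i = 1, ‖θ‖₂ ≤ S}`. -/
def dualParams (m : ℕ) (S : ℝ) : Set (EuclideanSpace ℝ (Fin m)) :=
  {θ | ∑ i, θ i = 1 ∧ ‖θ‖ ≤ S}

/-- The Euclidean projection onto `Θ` (the unique nearest point, as soon as `Θ` is nonempty). -/
noncomputable def projDualParams (m : ℕ) (S : ℝ) (v : EuclideanSpace ℝ (Fin m)) :
    EuclideanSpace ℝ (Fin m) :=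
  Classical.epsilon fun u => u ∈ dualParams m S ∧ ∀ u' ∈ dualParams m S, ‖v - u‖ ≤ ‖v - u'‖

namespace DiscountedMDP

variable {X A : Type*} [Fintype X] [DecidableEq X] [Fintype A] {m : ℕ}

/-- The iterates of the projected stochastic subgradient method with constant learning rate `ρ`,
started at `0`; round `t` uses the sample `s t = (i, x, a)`, of which only `(x, a)` enters. -/
noncomputable def sgdIter (M : DiscountedMDP X A) (π : Fin m → X → A → ℝ) (S H ρ : ℝ) {T : ℕ}
    (s : Fin T → Fin m × X × A) : ℕ → EuclideanSpace ℝ (Fin m)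
  | 0 => 0
  | t + 1 =>
    if h : t < T then
      projDualParams m S (M.sgdIter π S H ρ s t -
        ρ • M.subgrad π H (M.sgdIter π S H ρ s t) (s ⟨t, h⟩).2.1 (s ⟨t, h⟩).2.2)
    else M.sgdIter π S H ρ s t

/-- The output of the method after `T` rounds: the average of the first `T` iterates, run with the
learning rate `S / (G' √T)`, where `G' = √m + H m`. -/
noncomputable def sgdOutput (M : DiscountedMDP X A) (π : Fin m → X → A → ℝ) (S H : ℝ) {T : ℕ}
    (s : Fin T → Fin m × X × A) : EuclideanSpace ℝ (Fin m) :=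
  (1 / (T : ℝ)) • ∑ t ∈ Finset.range T,
    M.sgdIter π S H (S / ((√(m : ℝ) + H * m) * √(T : ℝ))) s t

open Classical in
/-- The probability of the event `E` when the samples of the `T` rounds are drawn independently,
each by choosing `i` uniformly among the `m` base policies and then `(x, a)` from `μ_{π i}`. -/
noncomputable def sampleProb (M : DiscountedMDP X A) (π : Fin m → X → A → ℝ) (T : ℕ)
    (E : (Fin T → Fin m × X × A) → Prop) : ℝ :=
  ∑ s : Fin T → Fin m × X × A,
    if E s then ∏ t, (1 / (m : ℝ)) * M.occ (π (s t).1) (s t).2.1 (s t).2.2 else 0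

end DiscountedMDP

/-- The parameter `(1 + lam) e_p - lam e_q`. -/
noncomputable def overlapParam {m : ℕ} (lam : ℝ) (p q : Fin m) : EuclideanSpace ℝ (Fin m) :=
  (1 + lam) • EuclideanSpace.single p 1 - lam • EuclideanSpace.single q 1

/-! ### Occupancy measures and the discounted flow equation -/

namespace DiscountedMDP

variable {X A : Type*} [Fintype X] [Fintype A] {m : ℕ}

/-! Everything is moved from policies to occupancy measures, where the cost is linear: `J π = cᵀ
μ_π`. A combination `ξ_θ` with weights of total one satisfies the same affine flow equation as an
occupancy measure and fails to be one only through its negative entries. Its positive part therefore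
solves the flow equation of `π_θ` up to an error of size `U(θ)`. Since the flow map contracts `ℓ¹`
by the factor `γ`, this error is amplified by at most `1/(1-γ)`. The result is
`sum_abs_xi_sub_occ_dualPolicy_le`, and from it `J(π_θ) ≤ cᵀ ξ_θ + 2/(1-γ) U(θ) + |∑ θ i - 1|`
(`J_dualPolicy_le`).

The comparison point is `θ° = (1+λ) e_p - λ e_q`. The overlap condition says exactly that `λ μ_q ≤
(1+λ) μ_p`, so `ξ_θ°` is nonnegative and `U(θ°) = 0`. Its linear cost is `J(π_p) - λ (J(π_q) -
J(π_p))`, and `J(π_p) ≤ J(π_*) + ε` because costs are bounded by one. This gives claims 1 and 2. For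
claim 3, a penalty `H ≥ 2/(1-γ)` already makes the surrogate dominate `J(π_θ)` on `Θ`, and the
surrogate at `θ°` is at most the bound.

For claim 4, the regret bound `two_mul_regret_le` for projected subgradient descent is combined with
convexity and with an Azuma–Hoeffding estimate (`one_sub_exp_le_sum_prod`) for the gradient noise.
With high probability the averaged iterate is then `η`-optimal against `θ°`
(`one_sub_le_sampleProb`). As `H = 1/η` and linear costs on the ball of radius `S` are at most `√m
S`, near-optimality forces `U = O(√m S η)`, and `J_dualPolicy_le` concludes. -/

theorem abs_sum_cost_mul_le (M : DiscountedMDP X A) (hcost : ∀ x a, |M.cost x a| ≤ 1)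
    (f : X → A → ℝ) : |∑ x, ∑ a, M.cost x a * f x a| ≤ ∑ x, ∑ a, |f x a| := by
  refine (Finset.abs_sum_le_sum_abs _ _).trans (Finset.sum_le_sum fun x _ => ?_)
  refine (Finset.abs_sum_le_sum_abs _ _).trans (Finset.sum_le_sum fun a _ => ?_)
  rw [abs_mul]
  exact mul_le_of_le_one_left (abs_nonneg _) (hcost x a)

variable [DecidableEq X]

theorem transition_mem_rowStochastic (M : DiscountedMDP X A) {π : X → A → ℝ} (hπ : IsPolicy π) :
    M.transition π ∈ Matrix.rowStochastic ℝ X := by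
  rw [Matrix.mem_rowStochastic_iff_sum]
  refine ⟨fun x y => ?_, fun x => ?_⟩
  · exact Finset.sum_nonneg fun a _ => mul_nonneg ((hπ x).1 a) ((M.P_mem x a).1 y)
  · simp only [transition, Matrix.of_apply]
    rw [Finset.sum_comm]
    simp_rw [← Finset.mul_sum, (M.P_mem x _).2, mul_one]
    exact (hπ x).2

theorem summable_discounted_pow (M : DiscountedMDP X A) {π : X → A → ℝ} (hπ : IsPolicy π)
    (x y : X) : Summable fun t : ℕ => M.γ ^ t * ((M.transition π) ^ t) x y := by
  have hmem : ∀ t : ℕ, (M.transition π) ^ t ∈ Matrix.rowStochastic ℝ X := fun t =>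
    pow_mem (M.transition_mem_rowStochastic hπ) t
  refine Summable.of_nonneg_of_le (fun t => ?_) (fun t => ?_)
    (summable_geometric_of_lt_one M.γ_pos.le M.γ_lt_one)
  · exact mul_nonneg (pow_nonneg M.γ_pos.le _) (Matrix.nonneg_of_mem_rowStochastic (hmem t))
  · exact mul_le_of_le_one_right (pow_nonneg M.γ_pos.le _)
      (Matrix.le_one_of_mem_rowStochastic (hmem t))

/-- The discounted sum of the powers of the transition matrix solves `R = 1 + γ R P_π`. -/
theorem tsum_discounted_pow (M : DiscountedMDP X A) {π : X → A → ℝ} (hπ : IsPolicy π) (x y : X) :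
    ∑' t : ℕ, M.γ ^ t * ((M.transition π) ^ t) x y = (if x = y then 1 else 0) +
      M.γ * ∑ z, (∑' t : ℕ, M.γ ^ t * ((M.transition π) ^ t) x z) * M.transition π z y := by
  rw [(M.summable_discounted_pow hπ x y).tsum_eq_zero_add]
  congr 1
  · simp [Matrix.one_apply]
  · simp_rw [← tsum_mul_right]
    rw [← Summable.tsum_finsetSum
      (fun z _ => (M.summable_discounted_pow hπ x z).mul_right _), ← tsum_mul_left]
    refine tsum_congr fun t => ?_
    rw [pow_succ, pow_succ, Matrix.mul_apply, Finset.mul_sum, Finset.mul_sum]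
    exact Finset.sum_congr rfl fun z _ => by ring

/-- The flow equation `νᵀ = (1 - γ) αᵀ + γ νᵀ P_π`. -/
theorem stateOcc_eq (M : DiscountedMDP X A) {π : X → A → ℝ} (hπ : IsPolicy π) (y : X) :
    M.stateOcc π y =
      (1 - M.γ) * M.init y + M.γ * ∑ x, M.stateOcc π x * M.transition π x y := by
  unfold stateOcc
  simp_rw [M.tsum_discounted_pow hπ _ y, mul_add, Finset.sum_add_distrib, mul_add]
  congr 1
  · simp
  · simp_rw [Finset.mul_sum, Finset.sum_mul]
    rw [Finset.sum_comm]
    simp_rw [Finset.mul_sum]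
    exact Finset.sum_congr rfl fun z _ => Finset.sum_congr rfl fun x _ => by ring

theorem stateOcc_nonneg (M : DiscountedMDP X A) {π : X → A → ℝ} (hπ : IsPolicy π) (x : X) :
    0 ≤ M.stateOcc π x := by
  refine mul_nonneg (sub_nonneg.2 M.γ_lt_one.le) (Finset.sum_nonneg fun x' _ =>
    mul_nonneg (M.init_mem.1 x') (tsum_nonneg fun t => mul_nonneg (pow_nonneg M.γ_pos.le _) ?_))
  exact Matrix.nonneg_of_mem_rowStochastic (pow_mem (M.transition_mem_rowStochastic hπ) t)

/-- Summing the flow equation over the states gives `(1-γ)(∑ ν - 1) = 0`, with no further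
manipulation of the series. -/
theorem sum_stateOcc (M : DiscountedMDP X A) {π : X → A → ℝ} (hπ : IsPolicy π) :
    ∑ x, M.stateOcc π x = 1 := by
  have hP := (Matrix.mem_rowStochastic_iff_sum.1 (M.transition_mem_rowStochastic hπ)).2
  have h : ∑ x, M.stateOcc π x = (1 - M.γ) + M.γ * ∑ x, M.stateOcc π x := by
    refine (Finset.sum_congr rfl fun x _ => M.stateOcc_eq hπ x).trans ?_
    rw [Finset.sum_add_distrib, ← Finset.mul_sum, ← Finset.mul_sum, M.init_mem.2,
      Finset.sum_comm]
    simp_rw [← Finset.mul_sum, hP, mul_one]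
  have h1 : (1 - M.γ) * (∑ x, M.stateOcc π x - 1) = 0 := by linarith
  rcases mul_eq_zero.1 h1 with h2 | h2
  · linarith [M.γ_lt_one]
  · linarith

theorem occ_nonneg (M : DiscountedMDP X A) {π : X → A → ℝ} (hπ : IsPolicy π) (x : X) (a : A) :
    0 ≤ M.occ π x a :=
  mul_nonneg (M.stateOcc_nonneg hπ x) ((hπ x).1 a)

theorem sum_occ_action (M : DiscountedMDP X A) {π : X → A → ℝ} (hπ : IsPolicy π) (x : X) :
    ∑ a, M.occ π x a = M.stateOcc π x := by
  simp only [occ]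
  rw [← Finset.mul_sum, (hπ x).2, mul_one]

theorem sum_occ (M : DiscountedMDP X A) {π : X → A → ℝ} (hπ : IsPolicy π) :
    ∑ x, ∑ a, M.occ π x a = 1 := by
  simp_rw [M.sum_occ_action hπ, M.sum_stateOcc hπ]

theorem sum_occ_action_eq (M : DiscountedMDP X A) {π : X → A → ℝ} (hπ : IsPolicy π) (y : X) :
    ∑ a, M.occ π y a =
      (1 - M.γ) * M.init y + M.γ * ∑ x, ∑ a, M.occ π x a * M.P x a y := by
  rw [M.sum_occ_action hπ, M.stateOcc_eq hπ]
  simp only [occ, transition, Matrix.of_apply, Finset.mul_sum, mul_assoc]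

/-- `J(π) = cᵀ μ_π`. -/
theorem J_eq_sum_occ (M : DiscountedMDP X A) {π : X → A → ℝ} (hπ : IsPolicy π) :
    M.J π = ∑ x, ∑ a, M.cost x a * M.occ π x a := by
  have h1 : ∀ x, M.valueFn π x = ∑ y, (1 - M.γ) *
      (∑' t : ℕ, M.γ ^ t * ((M.transition π) ^ t) x y) * M.policyCost π y := by
    intro x
    unfold valueFn
    simp_rw [mul_assoc, ← Finset.mul_sum, ← tsum_mul_right]
    rw [← Summable.tsum_finsetSum
      (fun z _ => (M.summable_discounted_pow hπ x z).mul_right _)]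
    congr 1
    refine tsum_congr fun t => ?_
    simp only [Matrix.mulVec, dotProduct, Finset.mul_sum, mul_assoc]
  have h2 : ∀ y, ∑ a, M.cost y a * M.occ π y a = M.stateOcc π y * M.policyCost π y := by
    intro y
    simp only [occ, policyCost, Finset.mul_sum]
    exact Finset.sum_congr rfl fun a _ => by ring
  simp_rw [h2]
  unfold J
  simp_rw [h1, Finset.mul_sum]
  rw [Finset.sum_comm]
  refine Finset.sum_congr rfl fun y _ => ?_
  rw [stateOcc, Finset.mul_sum, Finset.sum_mul]
  exact Finset.sum_congr rfl fun x _ => by ring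

/-- An approximate solution of the flow equation is close to the occupancy measure. -/
theorem sum_abs_sub_stateOcc_le (M : DiscountedMDP X A) {π : X → A → ℝ} (hπ : IsPolicy π)
    (u e : X → ℝ)
    (hu : ∀ y, u y = (1 - M.γ) * M.init y + M.γ * ∑ x, u x * M.transition π x y + e y) :
    (1 - M.γ) * ∑ y, |u y - M.stateOcc π y| ≤ ∑ y, |e y| := by
  obtain ⟨hP0, hP⟩ := Matrix.mem_rowStochastic_iff_sum.1 (M.transition_mem_rowStochastic hπ)
  have h : ∀ y, |u y - M.stateOcc π y| ≤
      M.γ * ∑ x, |u x - M.stateOcc π x| * M.transition π x y + |e y| := by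
    -- Subtracting the two flow equations removes the source term `(1-γ) α`; only transport of the
    -- difference and the error `e` remain.
    intro y
    have h1 : u y - M.stateOcc π y =
        M.γ * ∑ x, (u x - M.stateOcc π x) * M.transition π x y + e y := by
      rw [hu y, M.stateOcc_eq hπ y]
      simp only [sub_mul, Finset.sum_sub_distrib]
      ring
    rw [h1]
    refine (abs_add_le _ _).trans (add_le_add_left ?_ _)
    rw [abs_mul, abs_of_pos M.γ_pos]
    refine mul_le_mul_of_nonneg_left ((Finset.abs_sum_le_sum_abs _ _).trans
      (Finset.sum_le_sum fun x _ => ?_)) M.γ_pos.le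
    rw [abs_mul, abs_of_nonneg (hP0 x y)]
  -- Rows of the transition matrix sum to one, so after summation over `y` the transport term is
  -- exactly `γ` times the left side and can be absorbed.
  have h2 := Finset.sum_le_sum fun y (_ : y ∈ Finset.univ) => h y
  rw [Finset.sum_add_distrib, ← Finset.mul_sum, Finset.sum_comm] at h2
  simp_rw [← Finset.mul_sum, hP, mul_one] at h2
  linarith

/-! ### Signed combinations of occupancy measures and the policy they induce -/

theorem sum_xi_action (M : DiscountedMDP X A) {π : Fin m → X → A → ℝ} (hπ : ∀ i, IsPolicy (π i))
    (θ : EuclideanSpace ℝ (Fin m)) (y : X) :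
    ∑ a, M.xi π θ y a = (∑ i, θ i) * ((1 - M.γ) * M.init y) +
      M.γ * ∑ x, ∑ a, M.xi π θ x a * M.P x a y := by
  have h1 : ∑ a, M.xi π θ y a = ∑ i, θ i * ∑ a, M.occ (π i) y a := by
    simp only [xi, Finset.mul_sum]
    exact Finset.sum_comm
  have h2 : ∑ x, ∑ a, M.xi π θ x a * M.P x a y =
      ∑ i, θ i * ∑ x, ∑ a, M.occ (π i) x a * M.P x a y := by
    simp only [xi, Finset.mul_sum, Finset.sum_mul, mul_assoc]
    rw [Finset.sum_comm' (t' := Finset.univ) (s' := fun _ => Finset.univ) (by simp)]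
    rw [Finset.sum_comm]
    conv_rhs => rw [Finset.sum_comm]
    exact Finset.sum_congr rfl fun x _ => Finset.sum_comm
  rw [h1, h2]
  -- The flow equation is affine, so the total weight `∑ θ i` multiplies the source term. It is not
  -- set to one, because the averaged iterate has total weight `1 - 1/T`.
  simp_rw [M.sum_occ_action_eq (hπ _), mul_add, Finset.sum_add_distrib, Finset.sum_mul]
  congr 1
  rw [Finset.mul_sum]
  exact Finset.sum_congr rfl fun i _ => by ring

theorem sum_cost_mul_xi (M : DiscountedMDP X A) {π : Fin m → X → A → ℝ}
    (hπ : ∀ i, IsPolicy (π i)) (θ : EuclideanSpace ℝ (Fin m)) :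
    ∑ x, ∑ a, M.cost x a * M.xi π θ x a = ∑ i, θ i * M.J (π i) := by
  simp_rw [M.J_eq_sum_occ (hπ _), xi, Finset.mul_sum]
  rw [Finset.sum_comm (s := Finset.univ (α := Fin m))]
  refine Finset.sum_congr rfl fun x _ => ?_
  rw [Finset.sum_comm]
  exact Finset.sum_congr rfl fun i _ => Finset.sum_congr rfl fun a _ => by ring

theorem isPolicy_dualPolicy (M : DiscountedMDP X A) [Nonempty A] (π : Fin m → X → A → ℝ)
    (θ : EuclideanSpace ℝ (Fin m)) : IsPolicy (M.dualPolicy π θ) := by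
  intro x
  by_cases h : ∀ a', M.xi π θ x a' ≤ 0
  · refine ⟨fun a => ?_, ?_⟩
    · simp only [dualPolicy, if_pos h]; positivity
    · simp [dualPolicy, if_pos h]
  · refine ⟨fun a => ?_, ?_⟩
    · simp only [dualPolicy, if_neg h]
      exact div_nonneg (le_max_right _ _) (Finset.sum_nonneg fun a _ => le_max_right _ _)
    · simp only [dualPolicy, if_neg h]
      rw [← Finset.sum_div]
      refine div_self (ne_of_gt ?_)
      push Not at h
      obtain ⟨a, ha⟩ := h
      exact Finset.sum_pos' (fun a _ => le_max_right _ _)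
        ⟨a, Finset.mem_univ _, lt_max_of_lt_left ha⟩

/-- In the uniform branch both sides vanish, so this factorization of the positive part holds at
every state and later arguments need no case split. -/
theorem sum_max_xi_mul_dualPolicy (M : DiscountedMDP X A) (π : Fin m → X → A → ℝ)
    (θ : EuclideanSpace ℝ (Fin m)) (x : X) (a : A) :
    (∑ a', max (M.xi π θ x a') 0) * M.dualPolicy π θ x a = max (M.xi π θ x a) 0 := by
  by_cases h : ∀ a', M.xi π θ x a' ≤ 0
  · simp [max_eq_right (h _)]
  · simp only [dualPolicy, if_neg h]
    refine mul_div_cancel₀ _ (ne_of_gt ?_)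
    push Not at h
    obtain ⟨a, ha⟩ := h
    exact Finset.sum_pos' (fun a _ => le_max_right _ _)
      ⟨a, Finset.mem_univ _, lt_max_of_lt_left ha⟩

/-- `ξ_θ` is close to the occupancy measure of `π_θ` when the constraint violation is small. -/
theorem sum_abs_xi_sub_occ_dualPolicy_le (M : DiscountedMDP X A) [Nonempty A]
    {π : Fin m → X → A → ℝ} (hπ : ∀ i, IsPolicy (π i)) (θ : EuclideanSpace ℝ (Fin m)) :
    ∑ x, ∑ a, |M.occ (M.dualPolicy π θ) x a - M.xi π θ x a| ≤
      2 / (1 - M.γ) * M.violation π θ + |∑ i, θ i - 1| := by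
  have hγ : 0 < 1 - M.γ := sub_pos.2 M.γ_lt_one
  have hd := M.isPolicy_dualPolicy π θ
  set d := M.dualPolicy π θ with hd_def
  set n : X → A → ℝ := fun x a => |min (M.xi π θ x a) 0| with hn
  set u : X → ℝ := fun x => ∑ a, max (M.xi π θ x a) 0 with hu
  have hn0 : ∀ x a, 0 ≤ n x a := fun x a => abs_nonneg _
  have hmax : ∀ x a, max (M.xi π θ x a) 0 = M.xi π θ x a + n x a := by
    intro x a
    simp only [hn]
    rw [abs_of_nonpos (min_le_right _ _)]
    linarith [min_add_max (M.xi π θ x a) 0]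
  have hud : ∀ x a, u x * d x a = M.xi π θ x a + n x a := fun x a => by
    rw [← hmax]; exact M.sum_max_xi_mul_dualPolicy π θ x a
  have hU : M.violation π θ = ∑ x, ∑ a, n x a := rfl
  -- The defect of `u`, the state marginal of the positive part, in the flow equation of `π_θ`:
  -- wrong total weight, mass added at `y` by truncation, and the flow that this added mass would
  -- send into `y`.
  set e : X → ℝ := fun y => (∑ i, θ i - 1) * ((1 - M.γ) * M.init y) + ∑ a, n y a -
    M.γ * ∑ x, ∑ a, n x a * M.P x a y with he
  have hflow : ∀ y, u y = (1 - M.γ) * M.init y + M.γ * ∑ x, u x * M.transition d x y + e y := by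
    intro y
    have h1 : ∑ x, u x * M.transition d x y =
        ∑ x, ∑ a, M.xi π θ x a * M.P x a y + ∑ x, ∑ a, n x a * M.P x a y := by
      simp only [← Finset.sum_add_distrib, ← add_mul, ← hud, transition, Matrix.of_apply,
        Finset.mul_sum, mul_assoc]
    have h2 : u y = ∑ a, M.xi π θ y a + ∑ a, n y a := by
      rw [← Finset.sum_add_distrib]
      exact Finset.sum_congr rfl fun a _ => hmax y a
    rw [h1, h2, M.sum_xi_action hπ]
    simp only [he]
    ring
  have hpert := M.sum_abs_sub_stateOcc_le hd u e hflow
  have hesum : ∑ y, |e y| ≤ |∑ i, θ i - 1| * (1 - M.γ) + (1 + M.γ) * M.violation π θ := by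
    have h1 : ∀ y, |e y| ≤ |∑ i, θ i - 1| * ((1 - M.γ) * M.init y) + ∑ a, n y a +
        M.γ * ∑ x, ∑ a, n x a * M.P x a y := by
      intro y
      have hi : 0 ≤ (1 - M.γ) * M.init y := mul_nonneg hγ.le (M.init_mem.1 y)
      have hs : 0 ≤ ∑ a, n y a := Finset.sum_nonneg fun a _ => hn0 y a
      have hp : 0 ≤ M.γ * ∑ x, ∑ a, n x a * M.P x a y :=
        mul_nonneg M.γ_pos.le (Finset.sum_nonneg fun x _ => Finset.sum_nonneg fun a _ =>
          mul_nonneg (hn0 x a) ((M.P_mem x a).1 y))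
      refine (abs_sub _ _).trans ?_
      rw [abs_of_nonneg hp]
      refine add_le_add_left ((abs_add_le _ _).trans ?_) _
      rw [abs_mul, abs_of_nonneg hi, abs_of_nonneg hs]
    refine (Finset.sum_le_sum fun y _ => h1 y).trans (le_of_eq ?_)
    have h3 : ∑ y, ∑ x, ∑ a, n x a * M.P x a y = ∑ x, ∑ a, n x a := by
      rw [Finset.sum_comm]
      refine Finset.sum_congr rfl fun x _ => ?_
      rw [Finset.sum_comm]
      refine Finset.sum_congr rfl fun a _ => ?_
      rw [← Finset.mul_sum, (M.P_mem x a).2, mul_one]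
    rw [Finset.sum_add_distrib, Finset.sum_add_distrib, ← Finset.mul_sum, ← Finset.mul_sum,
      ← Finset.mul_sum, M.init_mem.2, h3, hU]
    ring
  -- Since `u · d = ξ + n`, replacing the state occupancy by `u` costs the state error, and
  -- replacing `ξ₊` by `ξ` costs `U(θ)`. The total coefficient is `1 + (1+γ)/(1-γ) = 2/(1-γ)`.
  have hsplit : ∑ x, ∑ a, |M.occ d x a - M.xi π θ x a| ≤
      ∑ x, |u x - M.stateOcc d x| + M.violation π θ := by
    rw [hU, ← Finset.sum_add_distrib]
    refine Finset.sum_le_sum fun x _ => ?_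
    have h1 : |u x - M.stateOcc d x| = ∑ a, |u x - M.stateOcc d x| * d x a := by
      rw [← Finset.mul_sum, (hd x).2, mul_one]
    rw [h1, ← Finset.sum_add_distrib]
    refine Finset.sum_le_sum fun a _ => ?_
    have h2 : M.occ d x a - M.xi π θ x a = n x a - (u x - M.stateOcc d x) * d x a := by
      rw [sub_mul, hud, occ]; ring
    rw [h2]
    refine (abs_sub _ _).trans (le_of_eq ?_)
    rw [abs_mul, abs_of_nonneg ((hd x).1 a), abs_of_nonneg (hn0 x a), add_comm]
  refine hsplit.trans ?_
  have h5 : ∑ x, |u x - M.stateOcc d x| ≤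
      (|∑ i, θ i - 1| * (1 - M.γ) + (1 + M.γ) * M.violation π θ) / (1 - M.γ) := by
    rw [le_div_iff₀ hγ, mul_comm]
    exact hpert.trans hesum
  refine (add_le_add_left h5 _).trans (le_of_eq ?_)
  field_simp
  ring

/-- The cost of `π_θ` is controlled by the linear cost of `ξ_θ` and the constraint violation. -/
theorem J_dualPolicy_le (M : DiscountedMDP X A) [Nonempty A]
    (hcost : ∀ x a, |M.cost x a| ≤ 1)
    {π : Fin m → X → A → ℝ} (hπ : ∀ i, IsPolicy (π i)) (θ : EuclideanSpace ℝ (Fin m)) :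
    M.J (M.dualPolicy π θ) ≤ ∑ x, ∑ a, M.cost x a * M.xi π θ x a +
      2 / (1 - M.γ) * M.violation π θ + |∑ i, θ i - 1| := by
  rw [M.J_eq_sum_occ (M.isPolicy_dualPolicy π θ)]
  have h1 := (le_abs_self _).trans (M.abs_sum_cost_mul_le hcost
    fun x a => M.occ (M.dualPolicy π θ) x a - M.xi π θ x a)
  have h2 := M.sum_abs_xi_sub_occ_dualPolicy_le hπ θ
  simp only [mul_sub, Finset.sum_sub_distrib] at h1
  linarith

theorem J_sub_J_le_l1Dist (M : DiscountedMDP X A) (hcost : ∀ x a, |M.cost x a| ≤ 1)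
    {π π' : X → A → ℝ} (hπ : IsPolicy π) (hπ' : IsPolicy π') :
    M.J π - M.J π' ≤ l1Dist (M.occ π) (M.occ π') := by
  rw [M.J_eq_sum_occ hπ, M.J_eq_sum_occ hπ']
  have h1 := (le_abs_self _).trans (M.abs_sum_cost_mul_le hcost
    fun x a => M.occ π x a - M.occ π' x a)
  simp only [mul_sub, Finset.sum_sub_distrib] at h1
  exact h1

theorem xi_overlapParam (M : DiscountedMDP X A) (π : Fin m → X → A → ℝ) (lam : ℝ) (p q : Fin m)
    (x : X) (a : A) : M.xi π (overlapParam lam p q) x a =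
      (1 + lam) * M.occ (π p) x a - lam * M.occ (π q) x a := by
  simp [xi, overlapParam, sub_mul, Finset.sum_sub_distrib]

theorem violation_nonneg (M : DiscountedMDP X A) (π : Fin m → X → A → ℝ)
    (θ : EuclideanSpace ℝ (Fin m)) : 0 ≤ M.violation π θ :=
  Finset.sum_nonneg fun _ _ => Finset.sum_nonneg fun _ _ => abs_nonneg _

theorem violation_eq_zero (M : DiscountedMDP X A) {π : Fin m → X → A → ℝ}
    {θ : EuclideanSpace ℝ (Fin m)} (h : ∀ x a, 0 ≤ M.xi π θ x a) : M.violation π θ = 0 :=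
  Finset.sum_eq_zero fun x _ => Finset.sum_eq_zero fun a _ => by simp [min_eq_right (h x a)]

end DiscountedMDP

theorem isPolicy_mixturePolicy {X A : Type*} [Fintype A] {m : ℕ} {π : Fin m → X → A → ℝ}
    (hπ : ∀ i, IsPolicy (π i)) {w : Fin m → ℝ} (hw : w ∈ stdSimplex ℝ (Fin m)) :
    IsPolicy (mixturePolicy π w) := by
  intro x
  refine ⟨fun a => Finset.sum_nonneg fun i _ => mul_nonneg (hw.1 i) ((hπ i x).1 a), ?_⟩
  simp only [mixturePolicy]
  rw [Finset.sum_comm]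
  simp_rw [← Finset.mul_sum, (hπ _ x).2, mul_one]
  exact hw.2

/-! ### Azuma–Hoeffding on finite product spaces -/

theorem Real.exp_mul_le_cosh_add_sinh {b d : ℝ} (hb : 0 < b) (hd : |d| ≤ b) (β : ℝ) :
    Real.exp (β * d) ≤ Real.cosh (β * b) + d / b * Real.sinh (β * b) := by
  obtain ⟨h1, h2⟩ := abs_le.1 hd
  have ha0 : 0 ≤ (b + d) / (2 * b) := div_nonneg (by linarith) (by linarith)
  have hb0 : 0 ≤ (b - d) / (2 * b) := div_nonneg (by linarith) (by linarith)
  -- On `[-b, b]` the convex function `exp (β ·)` lies below its chord; `d` is a convex combination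
  -- of `b` and `-b`.
  have h := convexOn_exp.2 (Set.mem_univ (β * b)) (Set.mem_univ (-(β * b))) ha0 hb0
    (by field_simp; ring)
  simp only [smul_eq_mul] at h
  have h3 : (b + d) / (2 * b) * (β * b) + (b - d) / (2 * b) * -(β * b) = β * d := by
    field_simp; ring
  rw [h3] at h
  refine h.trans (le_of_eq ?_)
  rw [Real.cosh_eq, Real.sinh_eq]
  field_simp
  ring

/-- Hoeffding's lemma for a finitely supported centred variable. -/
theorem sum_mul_exp_le_of_sum_eq_zero {Ω : Type*} [Fintype Ω] {p d : Ω → ℝ} (hp : ∀ ω, 0 ≤ p ω)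
    (hp1 : ∑ ω, p ω = 1) {b : ℝ} (hb : 0 < b) (hd : ∀ ω, |d ω| ≤ b)
    (hd0 : ∑ ω, p ω * d ω = 0) (β : ℝ) :
    ∑ ω, p ω * Real.exp (β * d ω) ≤ Real.exp ((β * b) ^ 2 / 2) := by
  refine (Finset.sum_le_sum fun ω _ => mul_le_mul_of_nonneg_left
    (Real.exp_mul_le_cosh_add_sinh hb (hd ω) β) (hp ω)).trans ?_
  have h : ∑ ω, p ω * (Real.cosh (β * b) + d ω / b * Real.sinh (β * b)) =
      (∑ ω, p ω) * Real.cosh (β * b) + (∑ ω, p ω * d ω) / b * Real.sinh (β * b) := by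
    rw [Finset.sum_mul, Finset.sum_div, Finset.sum_mul, ← Finset.sum_add_distrib]
    exact Finset.sum_congr rfl fun ω _ => by ring
  rw [h, hp1, hd0]
  simpa using Real.cosh_le_exp_half_sq (β * b)

/-- The Azuma--Hoeffding bound on the exponential moment of a martingale with bounded increments
on a finite product space; `d n s ω` is the increment after the history `s` and the sample `ω`. -/
theorem sum_prod_mul_exp_sum_le {Ω : Type*} [Fintype Ω] {p : Ω → ℝ} (hp : ∀ ω, 0 ≤ p ω)
    (hp1 : ∑ ω, p ω = 1) {b : ℝ} (hb : 0 < b) (d : ∀ n, (Fin n → Ω) → Ω → ℝ)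
    (hd : ∀ n s ω, |d n s ω| ≤ b) (hd0 : ∀ n s, ∑ ω, p ω * d n s ω = 0) (β : ℝ) (T : ℕ) :
    ∑ s : Fin T → Ω, (∏ t, p (s t)) *
      Real.exp (β * ∑ t : Fin T, d t (fun i => s (Fin.castLE t.2.le i)) (s t)) ≤
      Real.exp ((β * b) ^ 2 / 2) ^ T := by
  induction T with
  | zero => simp
  | succ T ih =>
    -- The last sample is split off: given the history, its increment contributes an independent
    -- factor bounded by Hoeffding's lemma, while the earlier increments do not see it.
    rw [← (Fin.snocEquiv fun _ : Fin (T + 1) => Ω).sum_comp, Fintype.sum_prod_type_right]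
    have h : ∀ (s : Fin T → Ω) (ω : Ω),
        (∏ t, p ((Fin.snocEquiv fun _ : Fin (T + 1) => Ω) (ω, s) t)) *
          Real.exp (β * ∑ t : Fin (T + 1),
            d t (fun i => (Fin.snocEquiv fun _ : Fin (T + 1) => Ω) (ω, s) (Fin.castLE t.2.le i))
              ((Fin.snocEquiv fun _ : Fin (T + 1) => Ω) (ω, s) t)) =
        ((∏ t, p (s t)) *
          Real.exp (β * ∑ t : Fin T, d t (fun i => s (Fin.castLE t.2.le i)) (s t))) *
          (p ω * Real.exp (β * d T s ω)) := by
      intro s ω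
      have hpre : ∀ (n : ℕ) (hn : n ≤ T) (i : Fin n),
          (Fin.snoc s ω : Fin (T + 1) → Ω) (Fin.castLE (hn.trans T.le_succ) i) =
            s (Fin.castLE hn i) := fun n hn i =>
        Fin.snoc_castSucc (α := fun _ => Ω) ω s (Fin.castLE hn i)
      have hlast : d T (fun i => (Fin.snoc s ω : Fin (T + 1) → Ω) (Fin.castLE T.le_succ i)) ω =
          d T s ω := by
        congr 1
        exact funext fun i => hpre T le_rfl i
      simp only [Fin.snocEquiv, Equiv.coe_fn_mk]
      rw [Fin.prod_univ_castSucc, Fin.sum_univ_castSucc, Fin.snoc_last]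
      simp only [Fin.snoc_castSucc]
      rw [mul_add, Real.exp_add]
      have hl : d (Fin.last T : Fin (T + 1))
          (fun i => (Fin.snoc s ω : Fin (T + 1) → Ω) (Fin.castLE (Fin.last T).2.le i)) ω =
          d T s ω := hlast
      have hc : ∀ t : Fin T, d (t.castSucc : Fin (T + 1))
          (fun i => (Fin.snoc s ω : Fin (T + 1) → Ω) (Fin.castLE t.castSucc.2.le i)) (s t) =
          d t (fun i => s (Fin.castLE t.2.le i)) (s t) := by
        intro t
        have hf : (fun i : Fin t => (Fin.snoc s ω : Fin (T + 1) → Ω)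
            (Fin.castLE (t.2.le.trans T.le_succ) i)) = fun i => s (Fin.castLE t.2.le i) :=
          funext fun i => hpre t t.2.le i
        exact congrArg (fun f => d t f (s t)) hf
      simp only [hl, hc]
      ring
    simp_rw [h, ← Finset.mul_sum]
    rw [pow_succ]
    calc _ ≤ ∑ s : Fin T → Ω, ((∏ t, p (s t)) *
          Real.exp (β * ∑ t : Fin T, d t (fun i => s (Fin.castLE t.2.le i)) (s t))) *
          Real.exp ((β * b) ^ 2 / 2) := by
          refine Finset.sum_le_sum fun s _ => mul_le_mul_of_nonneg_left
            (sum_mul_exp_le_of_sum_eq_zero hp hp1 hb (hd T s) (hd0 T s) β) ?_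
          exact mul_nonneg (Finset.prod_nonneg fun t _ => hp _) (Real.exp_pos _).le
      _ ≤ _ := by
          rw [← Finset.sum_mul]
          exact mul_le_mul_of_nonneg_right ih (Real.exp_pos _).le

open Classical in
/-- The Azuma--Hoeffding inequality on a finite product space. -/
theorem one_sub_exp_le_sum_prod {Ω : Type*} [Fintype Ω] {p : Ω → ℝ} (hp : ∀ ω, 0 ≤ p ω)
    (hp1 : ∑ ω, p ω = 1) {b : ℝ} (hb : 0 < b) (d : ∀ n, (Fin n → Ω) → Ω → ℝ)
    (hd : ∀ n s ω, |d n s ω| ≤ b) (hd0 : ∀ n s, ∑ ω, p ω * d n s ω = 0) (T : ℕ) {c : ℝ}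
    (hc : 0 ≤ c) {E : (Fin T → Ω) → Prop}
    (hE : ∀ s : Fin T → Ω,
      ∑ t : Fin T, d t (fun i => s (Fin.castLE t.2.le i)) (s t) ≤ T * c → E s) :
    1 - Real.exp (-(T * (c / b) ^ 2 / 2)) ≤
      ∑ s : Fin T → Ω, if E s then ∏ t, p (s t) else 0 := by
  have htot : ∑ s : Fin T → Ω, ∏ t, p (s t) = 1 := by
    have h := Finset.prod_univ_sum (fun _ : Fin T => (Finset.univ : Finset Ω)) fun _ ω => p ω
    simpa [hp1] using h.symm
  -- This minimizes the Chernoff exponent `T (β b)² / 2 - β T c`.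
  set β : ℝ := c / b ^ 2 with hβ
  set D : (Fin T → Ω) → ℝ := fun s =>
    ∑ t : Fin T, d t (fun i => s (Fin.castLE t.2.le i)) (s t) with hD
  have hβ0 : 0 ≤ β := by positivity
  -- Markov's inequality pointwise: off `E` the sum is at least `T c`, so the exponential weight is
  -- at least one.
  have hpt : ∀ s : Fin T → Ω, ∏ t, p (s t) ≤ (if E s then ∏ t, p (s t) else 0) +
      ((∏ t, p (s t)) * Real.exp (β * D s)) * Real.exp (-(β * (T * c))) := by
    intro s
    have h0 : 0 ≤ ∏ t, p (s t) := Finset.prod_nonneg fun t _ => hp _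
    by_cases h : E s
    · rw [if_pos h]
      have : 0 ≤ ((∏ t, p (s t)) * Real.exp (β * D s)) * Real.exp (-(β * (T * c))) := by
        positivity
      linarith
    · rw [if_neg h, zero_add, mul_assoc, ← Real.exp_add]
      have h1 : T * c ≤ D s := le_of_not_ge fun h1 => h (hE s h1)
      refine le_mul_of_one_le_right h0 (Real.one_le_exp ?_)
      linarith [mul_le_mul_of_nonneg_left h1 hβ0]
  have hsum := Finset.sum_le_sum fun s (_ : s ∈ Finset.univ) => hpt s
  rw [htot, Finset.sum_add_distrib, ← Finset.sum_mul] at hsum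
  have hmom := mul_le_mul_of_nonneg_right (sum_prod_mul_exp_sum_le hp hp1 hb d hd hd0 β T)
    (Real.exp_pos (-(β * (T * c)))).le
  rw [← Real.exp_nat_mul, ← Real.exp_add] at hmom
  have hexp : T * ((β * b) ^ 2 / 2) + -(β * (T * c)) = -(T * (c / b) ^ 2 / 2) := by
    rw [hβ]; field_simp; ring
  rw [hexp] at hmom
  linarith

/-! ### Euclidean projection onto the parameter set -/

theorem convex_dualParams (m : ℕ) (S : ℝ) : Convex ℝ (dualParams m S) := by
  have h : dualParams m S =
      {θ : EuclideanSpace ℝ (Fin m) | ∑ i, θ i = 1} ∩ Metric.closedBall 0 S := by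
    ext θ; simp [dualParams]
  rw [h]
  refine Convex.inter ?_ (convex_closedBall _ _)
  intro x hx y hy a b _ _ hab
  simp only [Set.mem_ofPred_eq] at hx hy ⊢
  simp only [PiLp.add_apply, PiLp.smul_apply, smul_eq_mul, Finset.sum_add_distrib,
    ← Finset.mul_sum, hx, hy, mul_one, hab]

theorem isClosed_dualParams (m : ℕ) (S : ℝ) : IsClosed (dualParams m S) := by
  refine IsClosed.inter (isClosed_eq ?_ continuous_const)
    (isClosed_le continuous_norm continuous_const)
  fun_prop

theorem projDualParams_spec {m : ℕ} {S : ℝ} (hne : (dualParams m S).Nonempty)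
    (v : EuclideanSpace ℝ (Fin m)) : projDualParams m S v ∈ dualParams m S ∧
      ∀ u' ∈ dualParams m S, ‖v - projDualParams m S v‖ ≤ ‖v - u'‖ := by
  refine Classical.epsilon_spec (p := fun u => u ∈ dualParams m S ∧
    ∀ u' ∈ dualParams m S, ‖v - u‖ ≤ ‖v - u'‖) ?_
  obtain ⟨u, hu, h⟩ := (isClosed_dualParams m S).exists_infDist_eq_dist hne v
  refine ⟨u, hu, fun u' hu' => ?_⟩
  rw [← dist_eq_norm, ← dist_eq_norm, ← h]
  exact Metric.infDist_le_dist_of_mem hu'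

/-- The obtuse-angle inequality `⟨v - u, θ - u⟩ ≤ 0` at the projection `u` makes projecting move
closer to every point of `Θ`. -/
theorem norm_projDualParams_sub_le {m : ℕ} {S : ℝ} {θ : EuclideanSpace ℝ (Fin m)}
    (hθ : θ ∈ dualParams m S) (v : EuclideanSpace ℝ (Fin m)) :
    ‖projDualParams m S v - θ‖ ≤ ‖v - θ‖ := by
  obtain ⟨hu, hmin⟩ := projDualParams_spec ⟨θ, hθ⟩ v
  set u := projDualParams m S v
  have hinf : ‖v - u‖ = ⨅ w : dualParams m S, ‖v - w‖ := by
    have : Nonempty (dualParams m S) := ⟨⟨θ, hθ⟩⟩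
    exact le_antisymm (le_ciInf fun w => hmin w w.2)
      (ciInf_le ⟨0, by rintro _ ⟨w, rfl⟩; exact norm_nonneg _⟩ (⟨u, hu⟩ : dualParams m S))
  have h := (norm_eq_iInf_iff_real_inner_le_zero (convex_dualParams m S) hu).1 hinf θ hθ
  have h1 : inner ℝ (v - u) (u - θ) = -inner ℝ (v - u) (θ - u) := by
    rw [← inner_neg_right, neg_sub]
  have h2 : ‖v - θ‖ ^ 2 = ‖v - u‖ ^ 2 + 2 * inner ℝ (v - u) (u - θ) + ‖u - θ‖ ^ 2 := by
    rw [← norm_add_sq_real, sub_add_sub_cancel]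
  refine (abs_le_of_sq_le_sq' ?_ (norm_nonneg _)).2
  nlinarith [sq_nonneg ‖v - u‖]

/-! ### Stochastic subgradients: regret, size and mean -/

namespace DiscountedMDP

variable {X A : Type*} [Fintype X] [DecidableEq X] [Fintype A] {m : ℕ}

/-- Iterate `k` reads only the first `k` samples. This adaptedness is what makes the gradient noise
a martingale difference sequence. -/
theorem sgdIter_prefix (M : DiscountedMDP X A) (π : Fin m → X → A → ℝ) (S H ρ : ℝ) {T n : ℕ}
    (hn : n ≤ T) (s : Fin T → Fin m × X × A) {k : ℕ} (hk : k ≤ n) :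
    M.sgdIter π S H ρ (fun i : Fin n => s (Fin.castLE hn i)) k = M.sgdIter π S H ρ s k := by
  induction k with
  | zero => simp [sgdIter]
  | succ k ih =>
    have h1 : k < n := hk
    have h2 : k < T := h1.trans_le hn
    simp only [sgdIter, dif_pos h1, dif_pos h2, ih h1.le]
    rfl

theorem sgdIter_mem (M : DiscountedMDP X A) (π : Fin m → X → A → ℝ) {S : ℝ} (H ρ : ℝ)
    (hne : (dualParams m S).Nonempty) {T : ℕ} (s : Fin T → Fin m × X × A) {k : ℕ} (hk : k < T) :
    M.sgdIter π S H ρ s (k + 1) ∈ dualParams m S := by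
  simp only [sgdIter, dif_pos hk]
  exact (projDualParams_spec hne _).1

/-- The start `0` is not in `Θ`, but it does lie in the ball of radius `S`, so the norm bound holds
for all iterates, including the initial one. -/
theorem norm_sgdIter_le (M : DiscountedMDP X A) (π : Fin m → X → A → ℝ) {S : ℝ} (H ρ : ℝ)
    (hne : (dualParams m S).Nonempty) {T : ℕ} (s : Fin T → Fin m × X × A) (k : ℕ) :
    ‖M.sgdIter π S H ρ s k‖ ≤ S := by
  obtain ⟨θ, hθ⟩ := hne
  induction k with
  | zero => simpa [sgdIter] using (norm_nonneg θ).trans hθ.2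
  | succ k ih =>
    by_cases hk : k < T
    · exact (M.sgdIter_mem π H ρ ⟨θ, hθ⟩ s hk).2
    · simpa only [sgdIter, dif_neg hk] using ih

/-- The regret bound of the projected subgradient method. -/
theorem two_mul_regret_le (M : DiscountedMDP X A) (π : Fin m → X → A → ℝ) {S H ρ G : ℝ}
    {θ : EuclideanSpace ℝ (Fin m)} (hθ : θ ∈ dualParams m S)
    (hG : ∀ θ x a, ‖M.subgrad π H θ x a‖ ≤ G) {T : ℕ}
    (s : Fin T → Fin m × X × A) :
    2 * ρ * ∑ t : Fin T, inner ℝ (M.subgrad π H (M.sgdIter π S H ρ s t) (s t).2.1 (s t).2.2)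
      (M.sgdIter π S H ρ s t - θ) ≤ ‖θ‖ ^ 2 + T * (ρ * G) ^ 2 := by
  have hstep : ∀ t : Fin T,
      2 * ρ * inner ℝ (M.subgrad π H (M.sgdIter π S H ρ s t) (s t).2.1 (s t).2.2)
        (M.sgdIter π S H ρ s t - θ) ≤
      (‖M.sgdIter π S H ρ s t - θ‖ ^ 2 - ‖M.sgdIter π S H ρ s (t + 1) - θ‖ ^ 2) +
        (ρ * G) ^ 2 := by
    intro t
    have h1 : M.sgdIter π S H ρ s (t + 1) = projDualParams m S (M.sgdIter π S H ρ s t -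
        ρ • M.subgrad π H (M.sgdIter π S H ρ s t) (s t).2.1 (s t).2.2) := by
      simp only [sgdIter, dif_pos t.2]
    have hg := hG (M.sgdIter π S H ρ s t) (s t).2.1 (s t).2.2
    set y := M.sgdIter π S H ρ s t
    set g := M.subgrad π H y (s t).2.1 (s t).2.2
    have h2 : ‖M.sgdIter π S H ρ s (t + 1) - θ‖ ^ 2 ≤ ‖(y - θ) - ρ • g‖ ^ 2 := by
      rw [h1, sub_right_comm]
      exact pow_le_pow_left₀ (norm_nonneg _) (norm_projDualParams_sub_le hθ _) 2
    rw [norm_sub_sq_real (y - θ), real_inner_smul_right, norm_smul, mul_pow, Real.norm_eq_abs, sq_abs,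
      real_inner_comm] at h2
    have h3 : ρ ^ 2 * ‖g‖ ^ 2 ≤ ρ ^ 2 * G ^ 2 :=
      mul_le_mul_of_nonneg_left (pow_le_pow_left₀ (norm_nonneg _) hg 2) (sq_nonneg _)
    rw [mul_pow]
    linarith
  -- The squared distances to `θ` telescope. Only `θ ∈ Θ` matters for the projection, so starting
  -- outside `Θ` is harmless, and the initial distance is `‖θ‖`.
  have hsum := Finset.sum_le_sum fun t (_ : t ∈ Finset.univ) => hstep t
  rw [← Finset.mul_sum, Finset.sum_add_distrib,
    Fin.sum_univ_eq_sum_range (fun t => ‖M.sgdIter π S H ρ s t - θ‖ ^ 2 -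
      ‖M.sgdIter π S H ρ s (t + 1) - θ‖ ^ 2) T, Finset.sum_range_sub'] at hsum
  have h0 : ‖M.sgdIter π S H ρ s 0 - θ‖ = ‖θ‖ := by simp [sgdIter]
  rw [h0] at hsum
  simp only [Finset.sum_const, Finset.card_univ, Fintype.card_fin, nsmul_eq_mul] at hsum
  linarith [sq_nonneg ‖M.sgdIter π S H ρ s T - θ‖]

theorem abs_J_le_one (M : DiscountedMDP X A) (hcost : ∀ x a, |M.cost x a| ≤ 1)
    {π : X → A → ℝ} (hπ : IsPolicy π) : |M.J π| ≤ 1 := by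
  rw [M.J_eq_sum_occ hπ]
  refine (M.abs_sum_cost_mul_le hcost _).trans (le_of_eq ?_)
  simp_rw [abs_of_nonneg (M.occ_nonneg hπ _ _), M.sum_occ hπ]

/-- The cost part is the vector of values `J (π j)`, each at most one in absolute value, hence `√m`.
The penalty part is `H m` times a subprobability vector, whose `ℓ²` norm is at most one. -/
theorem norm_subgrad_le (M : DiscountedMDP X A) (hcost : ∀ x a, |M.cost x a| ≤ 1)
    {π : Fin m → X → A → ℝ} (hπ : ∀ i, IsPolicy (π i)) {H : ℝ} (hH : 0 ≤ H)
    (θ : EuclideanSpace ℝ (Fin m)) (x : X) (a : A) :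
    ‖M.subgrad π H θ x a‖ ≤ √(m : ℝ) + H * m := by
  classical
  set v : EuclideanSpace ℝ (Fin m) := WithLp.toLp 2 fun j =>
    (M.occ (π j) x a / ∑ i, M.occ (π i) x a) * (if M.xi π θ x a < 0 then 1 else 0) with hv
  have hsplit : M.subgrad π H θ x a =
      WithLp.toLp 2 (fun j => M.J (π j)) - (H * m) • v := by
    ext j
    simp only [subgrad, hv, M.J_eq_sum_occ (hπ _), PiLp.sub_apply, PiLp.smul_apply, smul_eq_mul]
    ring
  have h1 : ‖(WithLp.toLp 2 (fun j => M.J (π j)) : EuclideanSpace ℝ (Fin m))‖ ≤ √(m : ℝ) := by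
    rw [EuclideanSpace.norm_eq]
    refine Real.sqrt_le_sqrt ((Finset.sum_le_sum (g := fun _ => (1 : ℝ)) fun j _ => ?_).trans
      (by simp))
    rw [Real.norm_eq_abs]
    exact pow_le_one₀ (abs_nonneg _) (M.abs_J_le_one hcost (hπ j))
  have h2 : ‖v‖ ≤ 1 := by
    have hs0 : 0 ≤ ∑ i, M.occ (π i) x a := Finset.sum_nonneg fun i _ => M.occ_nonneg (hπ i) x a
    have hr0 : ∀ j, 0 ≤ M.occ (π j) x a / ∑ i, M.occ (π i) x a := fun j =>
      div_nonneg (M.occ_nonneg (hπ j) x a) hs0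
    have hr1 : ∀ j, M.occ (π j) x a / ∑ i, M.occ (π i) x a ≤ 1 := fun j =>
      div_le_one_of_le₀ (Finset.single_le_sum (f := fun i => M.occ (π i) x a)
        (fun i _ => M.occ_nonneg (hπ i) x a) (Finset.mem_univ j)) hs0
    rw [EuclideanSpace.norm_eq, Real.sqrt_le_one]
    refine (Finset.sum_le_sum
      (g := fun j => M.occ (π j) x a / ∑ i, M.occ (π i) x a) fun j _ => ?_).trans ?_
    · simp only [hv]
      split_ifs
      · rw [mul_one, Real.norm_eq_abs, sq_abs]
        exact pow_le_of_le_one (hr0 j) (hr1 j) two_ne_zero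
      · simpa using hr0 j
    · rw [← Finset.sum_div]
      exact div_self_le_one _
  rw [hsplit]
  refine (norm_sub_le _ _).trans (add_le_add h1 ?_)
  rw [norm_smul, Real.norm_of_nonneg (by positivity)]
  exact mul_le_of_le_one_right (by positivity) h2

open Classical in
theorem inner_subgrad (M : DiscountedMDP X A) (π : Fin m → X → A → ℝ) (H : ℝ)
    (θ v : EuclideanSpace ℝ (Fin m)) (x : X) (a : A) :
    inner ℝ (M.subgrad π H θ x a) v = ∑ x', ∑ a', M.cost x' a' * M.xi π v x' a' -
      H * (m * M.xi π v x a / ∑ i, M.occ (π i) x a) * (if M.xi π θ x a < 0 then 1 else 0) := by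
  have h1 : ∑ x', ∑ a', M.cost x' a' * M.xi π v x' a' =
      ∑ j, v j * ∑ x', ∑ a', M.cost x' a' * M.occ (π j) x' a' := by
    simp_rw [xi, Finset.mul_sum]
    rw [Finset.sum_comm (s := Finset.univ (α := Fin m))]
    refine Finset.sum_congr rfl fun x _ => ?_
    rw [Finset.sum_comm]
    exact Finset.sum_congr rfl fun i _ => Finset.sum_congr rfl fun a _ => by ring
  rw [h1, PiLp.inner_apply]
  simp only [subgrad, RCLike.inner_apply, conj_trivial]
  conv_rhs => rw [xi]
  simp only [mul_sub, Finset.sum_sub_distrib, Finset.mul_sum, Finset.sum_div, Finset.sum_mul]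
  congr 1
  refine Finset.sum_congr rfl fun j _ => ?_
  ring

/-- The probability of a single sample `(i, x, a)`. -/
noncomputable def sampleWeight (M : DiscountedMDP X A) (π : Fin m → X → A → ℝ)
    (ω : Fin m × X × A) : ℝ :=
  1 / (m : ℝ) * M.occ (π ω.1) ω.2.1 ω.2.2

theorem sampleWeight_nonneg (M : DiscountedMDP X A) {π : Fin m → X → A → ℝ}
    (hπ : ∀ i, IsPolicy (π i)) (ω : Fin m × X × A) : 0 ≤ M.sampleWeight π ω :=
  mul_nonneg (by positivity) (M.occ_nonneg (hπ _) _ _)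

theorem sum_sampleWeight (M : DiscountedMDP X A) [NeZero m] {π : Fin m → X → A → ℝ}
    (hπ : ∀ i, IsPolicy (π i)) : ∑ ω, M.sampleWeight π ω = 1 := by
  simp only [sampleWeight, Fintype.sum_prod_type, ← Finset.mul_sum, M.sum_occ (hπ _)]
  simp [NeZero.ne m]

/-- The expected stochastic subgradient at `θ`. -/
noncomputable def meanSubgrad (M : DiscountedMDP X A) (π : Fin m → X → A → ℝ) (H : ℝ)
    (θ : EuclideanSpace ℝ (Fin m)) : EuclideanSpace ℝ (Fin m) :=
  ∑ ω, M.sampleWeight π ω • M.subgrad π H θ ω.2.1 ω.2.2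

theorem norm_meanSubgrad_le (M : DiscountedMDP X A) [NeZero m] {π : Fin m → X → A → ℝ}
    (hπ : ∀ i, IsPolicy (π i)) {H G : ℝ} {θ : EuclideanSpace ℝ (Fin m)}
    (hG : ∀ x a, ‖M.subgrad π H θ x a‖ ≤ G) : ‖M.meanSubgrad π H θ‖ ≤ G := by
  refine (norm_sum_le _ _).trans ((Finset.sum_le_sum
    (g := fun ω => M.sampleWeight π ω * G) fun ω _ => ?_).trans (le_of_eq ?_))
  · rw [norm_smul, Real.norm_of_nonneg (M.sampleWeight_nonneg hπ ω)]
    exact mul_le_mul_of_nonneg_left (hG _ _) (M.sampleWeight_nonneg hπ ω)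
  · rw [← Finset.sum_mul, M.sum_sampleWeight hπ, one_mul]

open Classical in
-- A sample hits `(x, a)` with probability `(1/m) ∑ μ_i(x, a)`, which the importance weight `m / ∑
-- μ_i(x, a)` cancels.
theorem inner_meanSubgrad (M : DiscountedMDP X A) [NeZero m] {π : Fin m → X → A → ℝ}
    (hπ : ∀ i, IsPolicy (π i)) (H : ℝ) (θ v : EuclideanSpace ℝ (Fin m)) :
    inner ℝ (M.meanSubgrad π H θ) v = ∑ x, ∑ a, M.cost x a * M.xi π v x a -
      H * ∑ x, ∑ a, M.xi π v x a * (if M.xi π θ x a < 0 then 1 else 0) := by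
  have hm : (m : ℝ) ≠ 0 := Nat.cast_ne_zero.2 (NeZero.ne m)
  simp only [meanSubgrad, sum_inner, real_inner_smul_left, M.inner_subgrad, mul_sub,
    Finset.sum_sub_distrib, ← Finset.sum_mul, M.sum_sampleWeight hπ, one_mul]
  congr 1
  simp only [Fintype.sum_prod_type, sampleWeight, Finset.mul_sum]
  rw [Finset.sum_comm]
  refine Finset.sum_congr rfl fun x _ => ?_
  rw [Finset.sum_comm]
  refine Finset.sum_congr rfl fun a _ => ?_
  by_cases hx : M.xi π θ x a < 0
  swap
  · simp only [if_neg hx, mul_zero, Finset.sum_const_zero]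
  simp only [if_pos hx, mul_one]
  rw [← Finset.sum_mul, ← Finset.mul_sum]
  -- Where no base policy puts mass the weight is a division by zero, but `ξ` vanishes there as
  -- well.
  by_cases h : ∑ i, M.occ (π i) x a = 0
  · have h0 : ∀ i, M.occ (π i) x a = 0 := fun i =>
      (Finset.sum_eq_zero_iff_of_nonneg fun i _ => M.occ_nonneg (hπ i) x a).1 h i
        (Finset.mem_univ i)
    simp [xi, h0]
  · field_simp

theorem xi_sub (M : DiscountedMDP X A) (π : Fin m → X → A → ℝ)
    (θ θ' : EuclideanSpace ℝ (Fin m)) (x : X) (a : A) :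
    M.xi π (θ - θ') x a = M.xi π θ x a - M.xi π θ' x a := by
  simp [xi, sub_mul, Finset.sum_sub_distrib]

/-- The expected stochastic subgradient is a subgradient of the surrogate. -/
theorem surrogate_sub_le (M : DiscountedMDP X A) [NeZero m] {π : Fin m → X → A → ℝ}
    (hπ : ∀ i, IsPolicy (π i)) {H : ℝ} (hH : 0 ≤ H) (θ θ' : EuclideanSpace ℝ (Fin m)) :
    M.surrogate π H θ - M.surrogate π H θ' ≤ inner ℝ (M.meanSubgrad π H θ) (θ - θ') := by
  classical
  -- Entrywise, `v ↦ |min v 0|` is convex, with subgradient `-1` where `v < 0` and `0` elsewhere.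
  have hpt : M.violation π θ - M.violation π θ' ≤
      -∑ x, ∑ a, M.xi π (θ - θ') x a * (if M.xi π θ x a < 0 then 1 else 0) := by
    simp only [violation, ← Finset.sum_sub_distrib, ← Finset.sum_neg_distrib]
    refine Finset.sum_le_sum fun x _ => Finset.sum_le_sum fun a _ => ?_
    rw [M.xi_sub, abs_of_nonpos (min_le_right _ _), abs_of_nonpos (min_le_right _ _)]
    split_ifs with h
    · rw [min_eq_left h.le]
      linarith [min_le_left (M.xi π θ' x a) 0]
    · rw [min_eq_right (not_lt.1 h)]
      linarith [min_le_right (M.xi π θ' x a) 0]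
  rw [M.inner_meanSubgrad hπ]
  have h := mul_le_mul_of_nonneg_left hpt hH
  have hc : ∑ x, ∑ a, M.cost x a * M.xi π (θ - θ') x a =
      ∑ x, ∑ a, M.cost x a * M.xi π θ x a - ∑ x, ∑ a, M.cost x a * M.xi π θ' x a := by
    simp only [M.xi_sub, mul_sub, Finset.sum_sub_distrib]
  rw [hc]
  simp only [surrogate]
  linarith

end DiscountedMDP

/-! ### The averaged iterate: total weight, noise and high-probability optimality -/

theorem EuclideanSpace.sum_abs_le_sqrt_mul_norm {m : ℕ} (θ : EuclideanSpace ℝ (Fin m)) :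
    ∑ i, |θ i| ≤ √(m : ℝ) * ‖θ‖ := by
  rw [EuclideanSpace.norm_eq, ← Real.sqrt_mul (Nat.cast_nonneg m)]
  refine Real.le_sqrt_of_sq_le ?_
  have h := sq_sum_le_card_mul_sum_sq (s := Finset.univ) (f := fun i => |θ i|)
  simpa [Real.norm_eq_abs] using h

namespace DiscountedMDP

variable {X A : Type*} [Fintype X] [DecidableEq X] [Fintype A] {m : ℕ}

theorem abs_sum_cost_mul_xi_le (M : DiscountedMDP X A) (hcost : ∀ x a, |M.cost x a| ≤ 1)
    {π : Fin m → X → A → ℝ} (hπ : ∀ i, IsPolicy (π i)) (θ : EuclideanSpace ℝ (Fin m)) :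
    |∑ x, ∑ a, M.cost x a * M.xi π θ x a| ≤ √(m : ℝ) * ‖θ‖ := by
  rw [M.sum_cost_mul_xi hπ]
  have h1 : |∑ i, θ i * M.J (π i)| ≤ ∑ i, |θ i| := by
    refine (Finset.abs_sum_le_sum_abs _ _).trans (Finset.sum_le_sum fun i _ => ?_)
    rw [abs_mul]
    exact mul_le_of_le_one_right (abs_nonneg _) (M.abs_J_le_one hcost (hπ i))
  exact h1.trans (EuclideanSpace.sum_abs_le_sqrt_mul_norm θ)

/-- The first of the `T` averaged iterates is `0` and has total weight zero; the other `T - 1` lie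
in `Θ`. -/
theorem sum_sgdOutput (M : DiscountedMDP X A) (π : Fin m → X → A → ℝ) {S : ℝ} (H : ℝ)
    (hne : (dualParams m S).Nonempty) {T : ℕ} (hT : 0 < T) (s : Fin T → Fin m × X × A) :
    ∑ i, M.sgdOutput π S H s i = 1 - 1 / (T : ℝ) := by
  have hT' : (T : ℝ) ≠ 0 := by positivity
  set y := M.sgdIter π S H (S / ((√(m : ℝ) + H * m) * √(T : ℝ))) s with hy
  have h1 : ∑ i, M.sgdOutput π S H s i = 1 / (T : ℝ) * ∑ t ∈ Finset.range T, ∑ i, y t i := by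
    rw [Finset.sum_comm, Finset.mul_sum]
    refine Finset.sum_congr rfl fun i _ => ?_
    simp only [sgdOutput, PiLp.smul_apply, smul_eq_mul, WithLp.ofLp_sum, Finset.sum_apply, hy]
  obtain ⟨n, rfl⟩ := Nat.exists_eq_succ_of_ne_zero hT.ne'
  have h2 : ∀ t ∈ Finset.range n, ∑ i, y (t + 1) i = 1 := fun t ht =>
    (M.sgdIter_mem π H _ hne s ((Finset.mem_range.1 ht).trans n.lt_succ_self)).1
  have h0 : ∑ i, y 0 i = 0 := by simp [hy, sgdIter]
  rw [h1, Finset.sum_range_succ', h0, Finset.sum_congr rfl h2]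
  push_cast at hT' ⊢
  simp only [Finset.sum_const, Finset.card_range, nsmul_eq_mul, mul_one, add_zero]
  field_simp
  ring

theorem norm_sgdOutput_le (M : DiscountedMDP X A) (π : Fin m → X → A → ℝ) {S : ℝ} (H : ℝ)
    (hne : (dualParams m S).Nonempty) {T : ℕ} (hT : 0 < T) (s : Fin T → Fin m × X × A) :
    ‖M.sgdOutput π S H s‖ ≤ S := by
  have hT' : (0 : ℝ) < T := by positivity
  rw [sgdOutput, norm_smul, Real.norm_of_nonneg (by positivity), one_div_mul_eq_div,
    div_le_iff₀' hT']
  refine (norm_sum_le _ _).trans ((Finset.sum_le_sum fun t _ =>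
    M.norm_sgdIter_le π H _ hne s t).trans (le_of_eq ?_))
  simp

/-- The martingale increment of the stochastic subgradient method at the iterate `y`. -/
noncomputable def gradNoise (M : DiscountedMDP X A) (π : Fin m → X → A → ℝ) (H : ℝ)
    (θ y : EuclideanSpace ℝ (Fin m)) (ω : Fin m × X × A) : ℝ :=
  inner ℝ (M.meanSubgrad π H y - M.subgrad π H y ω.2.1 ω.2.2) (y - θ)

theorem sum_sampleWeight_mul_gradNoise (M : DiscountedMDP X A) [NeZero m]
    {π : Fin m → X → A → ℝ} (hπ : ∀ i, IsPolicy (π i)) (H : ℝ)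
    (θ y : EuclideanSpace ℝ (Fin m)) :
    ∑ ω, M.sampleWeight π ω * M.gradNoise π H θ y ω = 0 := by
  simp only [gradNoise, inner_sub_left, mul_sub, Finset.sum_sub_distrib]
  rw [← Finset.sum_mul, M.sum_sampleWeight hπ, one_mul, meanSubgrad, sum_inner]
  simp only [real_inner_smul_left, sub_self]

/-- Cauchy–Schwarz with `2G` for the gradient difference and `2S` for the diameter of the ball. -/
theorem abs_gradNoise_le (M : DiscountedMDP X A) [NeZero m] {π : Fin m → X → A → ℝ}
    (hπ : ∀ i, IsPolicy (π i)) {H G S : ℝ} (hG : ∀ θ x a, ‖M.subgrad π H θ x a‖ ≤ G)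
    {θ y : EuclideanSpace ℝ (Fin m)} (hθ : ‖θ‖ ≤ S) (hy : ‖y‖ ≤ S) (ω : Fin m × X × A) :
    |M.gradNoise π H θ y ω| ≤ 4 * (S * G) := by
  have h1 : ‖M.meanSubgrad π H y - M.subgrad π H y ω.2.1 ω.2.2‖ ≤ G + G :=
    (norm_sub_le _ _).trans (add_le_add (M.norm_meanSubgrad_le hπ (hG y)) (hG y _ _))
  have h2 : ‖y - θ‖ ≤ S + S := (norm_sub_le _ _).trans (add_le_add hy hθ)
  refine (abs_real_inner_le_norm _ _).trans ((mul_le_mul h1 h2 (norm_nonneg _)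
    ((norm_nonneg _).trans h1)).trans (le_of_eq ?_))
  ring

/-- The optimization error of the averaged iterate in terms of the regret and the noise. -/
theorem surrogate_sgdOutput_sub_le (M : DiscountedMDP X A) [NeZero m]
    {π : Fin m → X → A → ℝ} (hπ : ∀ i, IsPolicy (π i)) {S H G : ℝ} (hH : 0 ≤ H)
    (hS : 0 < S) (hGm : G = √(m : ℝ) + H * m) (hG0 : 0 < G)
    (hG : ∀ θ x a, ‖M.subgrad π H θ x a‖ ≤ G)
    {θ : EuclideanSpace ℝ (Fin m)} (hθ : θ ∈ dualParams m S) {T : ℕ} (hT : 0 < T)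
    (s : Fin T → Fin m × X × A) :
    T * (M.surrogate π H (M.sgdOutput π S H s) - M.surrogate π H θ) ≤ S * G * √(T : ℝ) +
      ∑ t : Fin T, M.gradNoise π H θ (M.sgdIter π S H (S / (G * √(T : ℝ))) s t) (s t) := by
  subst hGm
  set G : ℝ := √(m : ℝ) + H * m with hGdef
  have hT' : (0 : ℝ) < T := by positivity
  have hsT : 0 < √(T : ℝ) := Real.sqrt_pos.2 hT'
  set ρ : ℝ := S / (G * √(T : ℝ)) with hρ
  have hρ0 : 0 < ρ := by positivity
  set y := M.sgdIter π S H ρ s with hy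
  set z := M.sgdOutput π S H s with hz
  have hzy : (T : ℝ) • z = ∑ t : Fin T, y t := by
    rw [Fin.sum_univ_eq_sum_range (fun t => y t) T, hz, sgdOutput, smul_smul,
      mul_one_div_cancel hT'.ne', one_smul]
  -- Jensen's inequality obtained from the subgradient inequality at the average `z`: the linear
  -- terms cancel because `∑ (z - y t) = 0`.
  have hjensen : T * M.surrogate π H z ≤ ∑ t : Fin T, M.surrogate π H (y t) := by
    have h1 := Finset.sum_le_sum fun (t : Fin T) (_ : t ∈ Finset.univ) =>
      M.surrogate_sub_le hπ hH z (y t)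
    have h2 : ∑ t : Fin T, (z - y t) = 0 := by
      rw [Finset.sum_sub_distrib, ← hzy, Finset.sum_const, Finset.card_univ, Fintype.card_fin,
        ← Nat.cast_smul_eq_nsmul ℝ, sub_self]
    rw [← inner_sum, h2, inner_zero_right, Finset.sum_sub_distrib] at h1
    simp only [Finset.sum_const, Finset.card_univ, Fintype.card_fin, nsmul_eq_mul] at h1
    linarith
  have hsub : ∑ t : Fin T, M.surrogate π H (y t) - T * M.surrogate π H θ ≤
      ∑ t : Fin T, inner ℝ (M.subgrad π H (y t) (s t).2.1 (s t).2.2) (y t - θ) +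
      ∑ t : Fin T, M.gradNoise π H θ (y t) (s t) := by
    have h1 := Finset.sum_le_sum fun (t : Fin T) (_ : t ∈ Finset.univ) =>
      M.surrogate_sub_le hπ hH (y t) θ
    rw [Finset.sum_sub_distrib] at h1
    simp only [Finset.sum_const, Finset.card_univ, Fintype.card_fin, nsmul_eq_mul] at h1
    refine h1.trans (le_of_eq ?_)
    rw [← Finset.sum_add_distrib]
    refine Finset.sum_congr rfl fun t _ => ?_
    rw [gradNoise, inner_sub_left]
    ring
  have hreg : ∑ t : Fin T, inner ℝ (M.subgrad π H (y t) (s t).2.1 (s t).2.2) (y t - θ) ≤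
      S * G * √(T : ℝ) := by
    have h1 := M.two_mul_regret_le π (ρ := ρ) hθ hG s
    have h2 : ‖θ‖ ^ 2 ≤ S ^ 2 := pow_le_pow_left₀ (norm_nonneg _) hθ.2 2
    -- The learning rate `ρ = S / (G √T)` balances the two terms of the regret bound, each being
    -- `S²`.
    have h3 : S ^ 2 + T * (ρ * G) ^ 2 = 2 * ρ * (S * G * √(T : ℝ)) := by
      have h4 : (√(T : ℝ)) ^ 2 = T := Real.sq_sqrt hT'.le
      have h5 : T * (ρ * G) ^ 2 = S ^ 2 := by
        rw [hρ, mul_pow, div_pow, mul_pow, h4]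
        field_simp
      rw [h5, hρ]
      field_simp
      ring
    refine le_of_mul_le_mul_left ?_ (mul_pos two_pos hρ0)
    linarith
  linarith

/-- With high probability the averaged iterate is an `η`-minimizer of the surrogate. -/
theorem one_sub_le_sampleProb (M : DiscountedMDP X A) [NeZero m]
    (hcost : ∀ x a, |M.cost x a| ≤ 1)
    {π : Fin m → X → A → ℝ} (hπ : ∀ i, IsPolicy (π i)) {S H η δ : ℝ} (hH : 0 ≤ H)
    (hS : 0 < S) (hη : 0 < η) (hδ : 0 < δ) (hδ1 : δ < 1)
    {θ : EuclideanSpace ℝ (Fin m)} (hθ : θ ∈ dualParams m S) {T : ℕ} (hT0 : 0 < T)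
    (hT : 128 * (S * (√(m : ℝ) + H * m) / η) ^ 2 * (1 + Real.log (1 / δ)) ≤ T)
    {E : (Fin T → Fin m × X × A) → Prop}
    (hE : ∀ s : Fin T → Fin m × X × A,
      M.surrogate π H (M.sgdOutput π S H s) - M.surrogate π H θ ≤ η → E s) :
    1 - δ ≤ M.sampleProb π T E := by
  classical
  have hT' : (0 : ℝ) < T := by positivity
  have hm : (0 : ℝ) < m := Nat.cast_pos.2 (NeZero.pos m)
  have hlog : 0 ≤ Real.log (1 / δ) := Real.log_nonneg ((one_le_div hδ).2 hδ1.le)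
  have hG := M.norm_subgrad_le hcost hπ hH
  set G : ℝ := √(m : ℝ) + H * m with hGdef
  have hG0 : 0 < G := add_pos_of_pos_of_nonneg (Real.sqrt_pos.2 hm) (by positivity)
  set ρ : ℝ := S / (G * √(T : ℝ)) with hρ
  have hb : 0 < 4 * (S * G) := by positivity
  set d : ∀ n, (Fin n → Fin m × X × A) → Fin m × X × A → ℝ := fun n s ω =>
    M.gradNoise π H θ (M.sgdIter π S H ρ s n) ω with hd
  have hQ : 0 < (S * G / η) ^ 2 := by positivity
  have hT1 : 128 * (S * G / η) ^ 2 ≤ T :=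
    (le_mul_of_one_le_right (by positivity) (by linarith)).trans hT
  have hT2 : 128 * (S * G / η) ^ 2 * Real.log (1 / δ) ≤ T :=
    (mul_le_mul_of_nonneg_left (by linarith) (by positivity)).trans hT
  have hsq : (√(T : ℝ)) ^ 2 = T := Real.sq_sqrt hT'.le
  -- The error budget `η` is split evenly between regret and noise.
  have hreg : S * G * √(T : ℝ) ≤ T * (η / 2) := by
    have h1 : 2 * (S * G / η) ≤ √(T : ℝ) := by
      refine Real.le_sqrt_of_sq_le ?_
      rw [mul_pow]
      linarith
    have h2 : S * G ≤ √(T : ℝ) * (η / 2) := by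
      have h3 : S * G = 2 * (S * G / η) * (η / 2) := by field_simp
      rw [h3]
      exact mul_le_mul_of_nonneg_right h1 (by positivity)
    calc S * G * √(T : ℝ) ≤ √(T : ℝ) * (η / 2) * √(T : ℝ) :=
          mul_le_mul_of_nonneg_right h2 (Real.sqrt_nonneg _)
      _ = T * (η / 2) := by rw [mul_right_comm, ← sq, hsq]
  have key := one_sub_exp_le_sum_prod (M.sampleWeight_nonneg hπ) (M.sum_sampleWeight hπ) hb d
    (fun n s ω => M.abs_gradNoise_le hπ hG hθ.2 (M.norm_sgdIter_le π H ρ ⟨θ, hθ⟩ s n) ω)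
    (fun n s => M.sum_sampleWeight_mul_gradNoise hπ H θ _) T (c := η / 2) (by positivity)
    (E := E) (fun s hs => hE s (by
      have h1 := M.surrogate_sgdOutput_sub_le hπ hH hS rfl hG0 hG hθ hT0 s
      have h2 : ∑ t : Fin T, d t (fun i => s (Fin.castLE t.2.le i)) (s t) =
          ∑ t : Fin T, M.gradNoise π H θ (M.sgdIter π S H ρ s t) (s t) :=
        Finset.sum_congr rfl fun t _ => by
          simp only [hd]
          rw [M.sgdIter_prefix π S H ρ t.2.le s le_rfl]
      rw [h2] at hs
      refine le_of_mul_le_mul_left ?_ hT'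
      linarith))
  have hexp : Real.exp (-(T * (η / 2 / (4 * (S * G))) ^ 2 / 2)) ≤ δ := by
    rw [← Real.le_log_iff_exp_le hδ]
    have h1 : Real.log (1 / δ) = -Real.log δ := by rw [one_div, Real.log_inv]
    -- Origin of 128: deviation `η/2` against increments `4 S G` gives `(8 S G / η)²`, doubled by
    -- the Gaussian exponent.
    have h2 : (T : ℝ) * (η / 2 / (4 * (S * G))) ^ 2 / 2 = T / (128 * (S * G / η) ^ 2) := by
      field_simp
      norm_num
    rw [h2]
    have h3 : Real.log (1 / δ) ≤ T / (128 * (S * G / η) ^ 2) := by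
      rw [le_div_iff₀ (by positivity), mul_comm]
      exact hT2
    linarith
  refine (sub_le_sub_left hexp 1).trans (key.trans (le_of_eq ?_))
  unfold sampleProb
  congr!

end DiscountedMDP

/-! ### The main theorem -/

theorem mainTheorem5 :
    ∃ K : ℝ, 0 < K ∧
    ∀ (X A : Type*) [Fintype X] [DecidableEq X] [Fintype A]
      (M : DiscountedMDP X A) (_hcost : ∀ x a, |M.cost x a| ≤ 1)
      (m : ℕ) (π : Fin m → X → A → ℝ) (_hπ : ∀ i, IsPolicy (π i))
      -- an optimal mixture of the base policies
      (w : Fin m → ℝ) (_hw : w ∈ stdSimplex ℝ (Fin m))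
      (_hmin : IsMinOn (fun w' => M.J (mixturePolicy π w')) (stdSimplex ℝ (Fin m)) w)
      -- the overlap condition
      (lam : ℝ) (_hlam : 0 < lam)
      (_hoverlap : ∀ (i j : Fin m) (x : X) (a : A),
        lam / (1 + lam) * M.occ (π j) x a ≤ M.occ (π i) x a ∧
        M.occ (π i) x a ≤ (1 + lam) / lam * M.occ (π j) x a)
      -- the two distinguished base policies
      (p q : Fin m)
      (S : ℝ) (_hS : overlapParam lam p q ∈ dualParams m S),
      let bound : ℝ := M.J (mixturePolicy π w)
        + l1Dist (M.occ (π p)) (M.occ (mixturePolicy π w))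
        - lam * (M.J (π q) - M.J (π p))
      M.violation π (overlapParam lam p q) = 0 ∧
      M.J (M.dualPolicy π (overlapParam lam p q)) ≤ bound ∧
      -- exact minimizers of the penalized convex problem
      (∀ H : ℝ, 6 / (1 - M.γ) ≤ H → ∀ θ ∈ dualParams m S,
        IsMinOn (M.surrogate π H) (dualParams m S) θ →
        M.J (M.dualPolicy π θ) ≤ bound) ∧
      -- the output of the stochastic subgradient method with `H = 1 / η`
      (∀ η δ : ℝ, 0 < η → η ≤ 1 → 0 < δ → δ < 1 → ∀ T : ℕ,
        K * (S * (√(m : ℝ) + 1 / η * m) / η) ^ 2 * (1 + Real.log (1 / δ)) ≤ T →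
        1 - δ ≤ M.sampleProb π T fun s =>
          M.J (M.dualPolicy π (M.sgdOutput π S (1 / η) s)) ≤
            bound + K * √(m : ℝ) * S / (1 - M.γ) * η) := by
  -- The value 128 is dictated by the Azuma–Hoeffding step; the final cost estimate only needs 8.
  refine ⟨128, by norm_num, ?_⟩
  intro X A _ _ _ M hcost m π hπ w hw _ lam hlam hoverlap p q S hS bound
  have : NeZero m := ⟨(Fin.pos p).ne'⟩
  have hX : Nonempty X := by
    by_contra h
    rw [not_nonempty_iff] at h
    simpa using M.init_mem.2
  have hA : Nonempty A := by
    by_contra h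
    rw [not_nonempty_iff] at h
    simpa using (hπ p hX.some).2
  have hγ : 0 < 1 - M.γ := sub_pos.2 M.γ_lt_one
  set θ₀ := overlapParam lam p q with hθ₀
  have hxi0 : ∀ x a, 0 ≤ M.xi π θ₀ x a := by
    intro x a
    have h1 := (hoverlap p q x a).1
    rw [div_mul_eq_mul_div, div_le_iff₀ (by linarith)] at h1
    rw [hθ₀, M.xi_overlapParam]
    linarith
  have hU := M.violation_eq_zero hxi0
  have hcost₀ : ∑ x, ∑ a, M.cost x a * M.xi π θ₀ x a ≤ bound := by
    have h1 : ∑ x, ∑ a, M.cost x a * M.xi π θ₀ x a =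
        (1 + lam) * M.J (π p) - lam * M.J (π q) := by
      rw [M.J_eq_sum_occ (hπ p), M.J_eq_sum_occ (hπ q)]
      simp only [hθ₀, M.xi_overlapParam, Finset.mul_sum, ← Finset.sum_sub_distrib]
      exact Finset.sum_congr rfl fun x _ => Finset.sum_congr rfl fun a _ => by ring
    have h2 := M.J_sub_J_le_l1Dist hcost (hπ p) (isPolicy_mixturePolicy hπ hw)
    rw [h1]
    simp only [bound]
    linarith
  have hsur₀ : ∀ H, M.surrogate π H θ₀ = ∑ x, ∑ a, M.cost x a * M.xi π θ₀ x a := fun H => by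
    rw [DiscountedMDP.surrogate, hU, mul_zero, add_zero]
  refine ⟨hU, ?_, ?_, ?_⟩
  · have h := M.J_dualPolicy_le hcost hπ θ₀
    rw [hU, hS.1] at h
    simp only [mul_zero, sub_self, abs_zero, add_zero] at h
    exact h.trans hcost₀
  · intro H hH θ hθ hmin
    have h := M.J_dualPolicy_le hcost hπ θ
    rw [hθ.1, sub_self, abs_zero, add_zero] at h
    have h1 : M.surrogate π H θ ≤ M.surrogate π H θ₀ := hmin hS
    -- The penalty pays for the whole rounding loss, so the surrogate dominates `J(π_θ)`.
    have h2 : 2 / (1 - M.γ) * M.violation π θ ≤ H * M.violation π θ :=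
      mul_le_mul_of_nonneg_right
        ((div_le_div_of_nonneg_right (by norm_num) hγ.le).trans hH) (M.violation_nonneg π θ)
    rw [hsur₀, DiscountedMDP.surrogate] at h1
    linarith
  · intro η δ hη hη1 hδ hδ1 T hT
    -- Membership of `θ°` in `Θ` forces this: its coordinates sum to one, so its `ℓ¹` norm is at
    -- least one. It lets plain multiples of `η` be absorbed into `√m S η / (1-γ)`.
    have hsS : 1 ≤ √(m : ℝ) * S :=
      (hS.1.symm.le.trans (Finset.sum_le_sum fun i _ => le_abs_self (θ₀ i))).trans
        ((EuclideanSpace.sum_abs_le_sqrt_mul_norm θ₀).trans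
          (mul_le_mul_of_nonneg_left hS.2 (Real.sqrt_nonneg _)))
    have hS0 : 0 < S := by
      by_contra h
      have := mul_nonpos_of_nonneg_of_nonpos (Real.sqrt_nonneg (m : ℝ)) (not_lt.1 h)
      linarith
    have hlog : 0 ≤ Real.log (1 / δ) := Real.log_nonneg ((one_le_div hδ).2 hδ1.le)
    -- Needed so that the weight defect `1/T` of the averaged iterate is at most `η`; it also shows
    -- that `T` is positive.
    have hTη : 1 / η ≤ (T : ℝ) := by
      have h1 : 1 ≤ 1 / η := (one_le_div hη).2 hη1
      have h2 : 1 / η ≤ S * (√(m : ℝ) + 1 / η * m) / η := by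
        refine div_le_div_of_nonneg_right ?_ hη.le
        have h3 : 0 ≤ S * (1 / η * m) := by positivity
        linarith
      have h4 := h2.trans (le_self_pow₀ (h1.trans h2) two_ne_zero)
      refine h4.trans (le_trans ?_ hT)
      rw [mul_right_comm]
      refine le_mul_of_one_le_left (sq_nonneg _) ?_
      linarith
    have hT0' : (0 : ℝ) < T := (one_div_pos.2 hη).trans_le hTη
    have hT0 : 0 < T := Nat.cast_pos.1 hT0'
    refine M.one_sub_le_sampleProb hcost hπ (one_div_nonneg.2 hη.le) hS0 hη hδ hδ1 hS hT0 hT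
      fun s hs => ?_
    set z := M.sgdOutput π S (1 / η) s with hz
    have h := M.J_dualPolicy_le hcost hπ z
    rw [M.sum_sgdOutput π (1 / η) ⟨θ₀, hS⟩ hT0 s, sub_sub_cancel_left, abs_neg,
      abs_of_pos (one_div_pos.2 hT0')] at h
    have hTinv : 1 / (T : ℝ) ≤ η := (one_div_le hη hT0').1 hTη
    have habs : ∀ θ ∈ Metric.closedBall (0 : EuclideanSpace ℝ (Fin m)) S,
        |∑ x, ∑ a, M.cost x a * M.xi π θ x a| ≤ √(m : ℝ) * S := fun θ hθ =>
      (M.abs_sum_cost_mul_xi_le hcost hπ θ).trans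
        (mul_le_mul_of_nonneg_left (mem_closedBall_zero_iff.1 hθ) (Real.sqrt_nonneg _))
    have ha := abs_le.1 (habs z (mem_closedBall_zero_iff.2
      (M.norm_sgdOutput_le π (1 / η) ⟨θ₀, hS⟩ hT0 s)))
    have hb := abs_le.1 (habs θ₀ (mem_closedBall_zero_iff.2 hS.2))
    rw [hsur₀, DiscountedMDP.surrogate] at hs
    have hV0 := M.violation_nonneg π z
    have hHV : 0 ≤ 1 / η * M.violation π z := by positivity
    -- Near-optimality gives `U/η ≤ cᵀ ξ_θ° - cᵀ ξ_z + η`, where the two costs contribute at most `2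
    -- √m S` and `η ≤ 1 ≤ √m S`.
    have hV : M.violation π z ≤ η * (3 * (√(m : ℝ) * S)) := by
      have h1 : 1 / η * M.violation π z ≤ 3 * (√(m : ℝ) * S) := by linarith [ha.1, hb.2]
      rwa [one_div_mul_eq_div, div_le_iff₀' hη] at h1
    have h2 : 2 / (1 - M.γ) * M.violation π z ≤ 6 * (√(m : ℝ) * S) / (1 - M.γ) * η := by
      refine (mul_le_mul_of_nonneg_left hV (by positivity)).trans (le_of_eq ?_)
      ring
    have h3 : η ≤ √(m : ℝ) * S / (1 - M.γ) * η := by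
      refine le_mul_of_one_le_left hη.le ?_
      rw [one_le_div hγ]
      linarith [M.γ_pos]
    -- Six units pay for the constraint violation; two of the remaining 122 cover the optimization
    -- error `η` and the weight defect `1/T ≤ η`.
    have h4 : 128 * √(m : ℝ) * S / (1 - M.γ) * η =
        6 * (√(m : ℝ) * S) / (1 - M.γ) * η + 122 * (√(m : ℝ) * S / (1 - M.γ) * η) := by ring
    rw [h4]
    linarith
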